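/- **The DP-RAM scheme.** Let $(\mathsf{KeyGen},\mathsf{Enc},\mathsf{Dec})$ be a randomized symmetric encryption scheme with perfectly correct decryption, let $n\ge 1$ and let $p\in[0,1]$ be the stash probability. The server holds an array $A$ of $n$ ciphertexts; the client holds a key $K$ and a *stash*, i.e. a partial map from $[n]$ to blocks. *Setup* on a database $(B_1,\dots,B_n)$: draw $K$; for each $i\in[n]$ independently set $A[i]\leftarrow\mathsf{Enc}(K,B_i)$ and, with probability $p$, put $B_i$ into the stash as well. *Query* $(i,\mathsf{op})\in[n]\times\{\mathsf{read},\mathsf{write}\}$ (with a new content $B_{\mathrm{new}}$, used by writes only). Download phase: if $i$ is in the stash, pick $d\in[n]$ uniformly at random, download and discard $A[d]$, let $B$ be the stashed block and remove it from the stash; otherwise set $d=i$, download $A[d]$ and let $B=\mathsf{Dec}(K,A[d])$. If $\mathsf{op}=\mathsf{write}$, set $B\leftarrow B_{\mathrm{new}}$. Overwrite phase: with probability $p$ (fresh randomness), put $B$ into the stash under index $i$, pick $o\in[n]$ uniformly at random, download $A[o]$, re-encrypt its content and upload it as $A[o]$; otherwise set $o=i$, download and discard $A[o]$ and upload a fresh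 $\mathsf{Enc}(K,B)$ as $A[o]$. The query answers $B$. (Implementing both coin flips by drawing $r\in\{1,\dots,n\}$ uniformly and testing $r\le C$ for an integer $1\le C\le n$ is the case $p=C/n\geq 1/n$.) The *view* of the server on a query sequence $Q=(q_1,\dots,q_l)$ is the sequence of its server operations "download $A[d_j]$, download $A[o_j]$, upload $A[o_j]$", $j=1,\dots,l$; encrypted contents are treated as opaque and are not part of the view. The scheme is *$\epsilon$-differentially private* if for all $l$, all $Q_1,Q_2\in([n]\times\{\mathsf{read},\mathsf{write}\})^l$ that differ in exactly one position, and all sets $T$ of views, $\Pr[\mathrm{view}(Q_1)\in T]\le e^{\epsilon}\Pr[\mathrm{view}(Q_2)\in T]$. **Theorem.** 1. (Privacy.) For every $k\in\mathbb N$ there is a constant $K_0$ such that for all $n\ge1$ and all stash probabilities $p$ with $n^{-k}\le p\le 1$, the scheme is $\epsilon$-differentially private with $\epsilon=K_0\log n$, for every encryption scheme and every database, and whatever contents are written (the contents written may depend arbitrarily on the query sequence). 2. (Correctness and bandwidth.) For all $n\ge1$ and $p\in[0,1]$, in every execution all answers are correct, i.e. equal to those of an ordinary memory initialised with the database, and each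 query downloads at most $2$ blocks and uploads at most $1$ block. 3. (Client storage.) There is an absolute constant $A_0$ such that for every $c:\mathbb N\to\mathbb R$ with $c(n)=\omega(\log n)$ and every polynomially bounded $L:\mathbb N\to\mathbb N$ there is a negligible function $\nu$ (that is, $n^m\nu(n)\to0$ for every $m$) with the following property. For all $n\ge1$, all $p\le c(n)/n$, every encryption scheme, every database and every sequence of at most $L(n)$ queries with any written contents, the probability that at some point in time (after setup, or after one of the two phases of some query) the client holds more than $A_0\,c(n)$ blocks is at most $\nu(n)$. Here the blocks held are those in the stash plus three working blocks. -/

import Mathlib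

open Filter Topology Asymptotics

namespace DPRAM

/-! ### Differentially private access -/

/-- A storage primitive with query space `𝒬` is given by the law `S l Q` of the server's view on
the query sequence `Q` of length `l`.  It provides `(ε, δ)`-differentially private access if the
defining inequality holds for all events and all adjacent sequences of the same length, i.e.
sequences at Hamming distance exactly one. -/
def IsDPAccess {𝒬 View : Type*} [DecidableEq 𝒬] (S : ∀ l : ℕ, (Fin l → 𝒬) → PMF View)
    (ε δ : ℝ) : Prop :=
  ∀ (l : ℕ) (Q₁ Q₂ : Fin l → 𝒬), hammingDist Q₁ Q₂ = 1 → ∀ T : Set View,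
    (S l Q₁).toOuterMeasure T ≤
      ENNReal.ofReal (Real.exp ε) * (S l Q₂).toOuterMeasure T + ENNReal.ofReal δ

/-! ### Queries and the semantics of random access memory -/

inductive Op : Type
  | read
  | write
  deriving DecidableEq

/-- A query is a pair (record index, operation). -/
abbrev Query (n : ℕ) : Type := Fin n × Op

/-- The answers of an ordinary memory holding `mem` to a list of queries.  The second component of
each entry is the new content of the block, which is used by a write only.  A read answers the
current content of the block and a write answers the content just written. -/
def plainAnswers {n : ℕ} {Block : Type*} :
    (Fin n → Block) → List (Query n × Block) → List Block
  | _, [] => []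
  | mem, ((i, Op.read), _) :: xs => mem i :: plainAnswers mem xs
  | mem, ((i, Op.write), b) :: xs => b :: plainAnswers (Function.update mem i b) xs

/-! ### Ingredients of the scheme -/

/-- A symmetric encryption scheme: randomized key generation and encryption, and a decryption
that always recovers the plaintext. -/
structure EncScheme (Key Block Ct : Type*) where
  keyGen : PMF Key
  enc : Key → Block → PMF Ct
  dec : Key → Ct → Block
  dec_enc : ∀ k ∈ keyGen.support, ∀ b, ∀ ct ∈ (enc k b).support, dec k ct = b

/-- A coin that shows `true` with probability `p`. -/
noncomputable def coin (p : unitInterval) : PMF Bool :=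
  PMF.ofFintype (fun b => cond b (ENNReal.ofReal p) (ENNReal.ofReal (1 - p))) (by
    have h : (0 : ℝ) ≤ 1 - p := sub_nonneg.2 p.2.2
    simp [← ENNReal.ofReal_add p.2.1 h])

/-- Drawing `r` uniformly from `{1, …, n}` and testing `r ≤ C` is the coin of bias `C / n`. -/
theorem map_uniform_eq_coin (n : ℕ) [NeZero n] (C : ℕ) (p : unitInterval)
    (hp : (p : ℝ) = C / n) :
    (PMF.uniformOfFintype (Fin n)).map (fun r : Fin n => decide ((r : ℕ) + 1 ≤ C)) = coin p := by
  have hn : (0 : ℝ) < n := by exact_mod_cast Nat.pos_of_ne_zero (NeZero.ne n)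
  have hC : C ≤ n := by
    have h1 := p.2.2
    rw [hp, div_le_one hn] at h1
    exact_mod_cast h1
  have hT : (PMF.uniformOfFintype (Fin n)).map (fun r : Fin n => decide ((r : ℕ) + 1 ≤ C)) true
      = coin p true := by
    have hcard : (Finset.univ.filter fun r : Fin n => (r : ℕ) + 1 ≤ C).card = C := by
      have h : (Finset.univ.filter fun r : Fin n => (r : ℕ) < C).card = min n C :=
        Fin.card_filter_val_lt
      simpa [Nat.succ_le_iff, Nat.min_eq_right hC] using h
    have e1 : (PMF.uniformOfFintype (Fin n)).map (fun r : Fin n => decide ((r : ℕ) + 1 ≤ C)) true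
        = ∑ r : Fin n, if (r : ℕ) + 1 ≤ C then (n : ENNReal)⁻¹ else 0 := by
      refine (PMF.map_apply _ _ _).trans ?_
      rw [tsum_fintype]
      refine Finset.sum_congr rfl fun r _ => ?_
      by_cases h : (r : ℕ) + 1 ≤ C <;> simp [h]
    rw [e1, ← Finset.sum_filter, Finset.sum_const, hcard]
    simp only [coin, PMF.ofFintype_apply, cond_true, hp, nsmul_eq_mul]
    rw [ENNReal.ofReal_div_of_pos hn, ENNReal.ofReal_natCast, ENNReal.ofReal_natCast,
      div_eq_mul_inv]
  have key : ∀ P : PMF Bool, P false = 1 - P true := fun P => by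
    have h := P.tsum_coe
    rw [tsum_fintype, Fintype.sum_bool] at h
    rw [← h]
    exact (ENNReal.add_sub_cancel_left (P.apply_ne_top true)).symm
  ext b
  cases b
  · rw [key, key, hT]
  · exact hT

/-- Independent draws, one after the other, for the indices `0, …, n - 1`. -/
noncomputable def drawAll {α : Type*} : ∀ {n : ℕ}, (Fin n → PMF α) → PMF (Fin n → α)
  | 0, _ => PMF.pure Fin.elim0
  | _ + 1, f => (f 0).bind fun a => (drawAll fun i => f i.succ).map fun g => Fin.cons a g

/-- Joint state: the client's key and block stash (a hash table from indices to blocks) and the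
server's array of `n` ciphertexts. -/
structure State (n : ℕ) (Key Block Ct : Type*) where
  key : Key
  stash : Fin n → Option Block
  server : Fin n → Ct

/-- What the server is asked to do: send, or replace, the array entry at an address.  The
encrypted content that is moved is treated as opaque and is not part of the server's view. -/
inductive ServerOp (n : ℕ) : Type
  | download (d : Fin n)
  | upload (o : Fin n)

def ServerOp.isDownload {n : ℕ} : ServerOp n → Bool
  | .download _ => true
  | .upload _ => false

def ServerOp.isUpload {n : ℕ} : ServerOp n → Bool
  | .download _ => false
  | .upload _ => true

section Scheme

variable {n : ℕ} {Key Block Ct : Type*}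

/-- The number of blocks in the stash. -/
def State.stashSize (s : State n Key Block Ct) : ℕ :=
  (Finset.univ.filter fun i => (s.stash i).isSome).card

/-- The number of blocks for which the client has reserved memory: the stash and three working
blocks (the block `B` of the current query, its new content, and the block being moved). -/
def State.clientBlocks (s : State n Key Block Ct) : ℕ := s.stashSize + 3

/-- Setup: each block is encrypted and stored at the server, and is in addition put into the stash
with probability `p`, independently of the others. -/
noncomputable def setup (E : EncScheme Key Block Ct) (p : unitInterval) (D : Fin n → Block) :
    PMF (State n Key Block Ct) :=
  E.keyGen.bind fun k =>
    (drawAll fun i : Fin n =>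
      (E.enc k (D i)).bind fun ct =>
        (coin p).map fun r => (ct, if r then some (D i) else none)).map fun cells =>
          { key := k, stash := fun i => (cells i).2, server := fun i => (cells i).1 }

/-- Download phase of a query to block `i`: the new state, the block found, and the address `d`
that is downloaded. -/
noncomputable def downloadPhase [NeZero n] (E : EncScheme Key Block Ct)
    (s : State n Key Block Ct) (i : Fin n) : PMF (State n Key Block Ct × Block × Fin n) :=
  match s.stash i with
  | some B => (PMF.uniformOfFintype (Fin n)).map fun d =>
      ({ s with stash := Function.update s.stash i none }, B, d)
  | none => PMF.pure (s, E.dec s.key (s.server i), i)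

/-- Overwrite phase of a query to block `i` whose current content is `B`: the new state and the
address `o` that is downloaded and then overwritten. -/
noncomputable def overwritePhase [NeZero n] (E : EncScheme Key Block Ct) (p : unitInterval)
    (s : State n Key Block Ct) (i : Fin n) (B : Block) : PMF (State n Key Block Ct × Fin n) :=
  (coin p).bind fun r =>
    if r then
      (PMF.uniformOfFintype (Fin n)).bind fun o =>
        (E.enc s.key (E.dec s.key (s.server o))).map fun ct =>
          ({ s with stash := Function.update s.stash i (some B),
                    server := Function.update s.server o ct }, o)
    else
      (E.enc s.key B).map fun ct =>
        ({ s with server := Function.update s.server i ct }, i)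

/-- The outcome of one query: the states after the download phase and after the overwrite phase,
the answer, and the requests made to the server. -/
structure QueryResult (n : ℕ) (Key Block Ct : Type*) where
  mid : State n Key Block Ct
  final : State n Key Block Ct
  answer : Block
  ops : List (ServerOp n)

/-- A query with record index `q.1`, operation `q.2` and new content `Bnew` (ignored by reads). -/
noncomputable def query [NeZero n] (E : EncScheme Key Block Ct) (p : unitInterval)
    (s : State n Key Block Ct) (q : Query n) (Bnew : Block) :
    PMF (QueryResult n Key Block Ct) :=
  (downloadPhase E s q.1).bind fun x =>
    let B : Block := match q.2 with
      | Op.read => x.2.1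
      | Op.write => Bnew
    (overwritePhase E p x.1 q.1 B).map fun y =>
      { mid := x.1
        final := y.1
        answer := B
        ops := [ServerOp.download x.2.2, ServerOp.download y.2, ServerOp.upload y.2] }

/-- Record of an execution: the requests made to the server in each query (the server's view), the
answers, and the number of blocks held by the client at the successive points in time, namely after
setup and after each phase of each query. -/
structure Execution (n : ℕ) (Block : Type*) where
  view : List (List (ServerOp n))
  answers : List Block
  clientLoads : List ℕ

noncomputable def run [NeZero n] (E : EncScheme Key Block Ct) (p : unitInterval) :
    State n Key Block Ct → List (Query n × Block) → PMF (Execution n Block)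
  | s, [] => PMF.pure { view := [], answers := [], clientLoads := [s.clientBlocks] }
  | s, x :: xs => (query E p s x.1 x.2).bind fun r => (run E p r.final xs).map fun e =>
      { view := r.ops :: e.view
        answers := r.answer :: e.answers
        clientLoads := s.clientBlocks :: r.mid.clientBlocks :: e.clientLoads }

/-- The list of inputs of the query algorithm for the query sequence `Q` with written contents
`W`. -/
def inputs {l : ℕ} (Q : Fin l → Query n) (W : Fin l → Block) : List (Query n × Block) :=
  List.ofFn fun j => (Q j, W j)

/-- Setup on the database `D` followed by the query sequence `Q` with written contents `W`. -/
noncomputable def execute [NeZero n] (E : EncScheme Key Block Ct) (p : unitInterval)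
    (D : Fin n → Block) {l : ℕ} (Q : Fin l → Query n) (W : Fin l → Block) :
    PMF (Execution n Block) :=
  (setup E p D).bind fun s => run E p s (inputs Q W)

end Scheme

end DPRAM

namespace DPRAM

/-! ### Independent draws -/

/-! The view and the client loads depend on the blocks, keys and ciphertexts only through the set of
stashed indices (`map_execute`). That set starts as n independent coins of bias p, and a query to i
replaces coordinate i by a fresh coin. So privacy and storage are statements about `stashRun`;
correctness is a separate invariant of the memory represented by the state.

Privacy: fix a view v and regard its probability as a function of the current stash S. Putting i
into S loses at most a factor n (`dominated_viewLaw`), because the two processes have the same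
weights up to the next query to i, which then downloads a uniform address, and the fresh coin makes
them agree afterwards. Hence a query to i, together with its entry (d, o) of the view, can be
inserted or deleted at polynomial cost, provided that the larger side starts with i stashed
(`Dominated`). This proviso is paid for once: by the previous query to i, which stashes i and
overwrites any prescribed address with probability p/n, or by setup, which stashes i with
probability p. Replacing a by b is a deletion followed by an insertion, and the pointwise bound on
probabilities of views passes to all events.

Storage: redrawing one coordinate preserves the product law (`drawAll_bind_update`), so after every
query the stash again consists of n independent coins. A union bound over time and a Chernoff bound
finish the argument. -/

theorem map_drawAll {α β : Type*} (h : α → β) : ∀ {n : ℕ} (f : Fin n → PMF α),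
    (drawAll f).map (fun g i => h (g i)) = drawAll fun i => (f i).map h
  | 0, f => by
    simp only [drawAll, PMF.pure_map]
    congr 1
    exact Subsingleton.elim _ _
  | n + 1, f => by
    simp only [drawAll, PMF.map_bind, PMF.map_comp, PMF.bind_map, ← map_drawAll h]
    congr 1
    funext a
    simp only [Function.comp_apply]
    congr 1
    funext g i
    refine Fin.cases ?_ (fun j => ?_) i <;> simp

theorem drawAll_apply {α : Type*} : ∀ {n : ℕ} (f : Fin n → PMF α) (g : Fin n → α),
    drawAll f g = ∏ i, f i (g i)
  | 0, f, g => by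
    rw [Subsingleton.elim g Fin.elim0]
    simp [drawAll]
  | n + 1, f, g => by
    classical
    have hmap : ∀ a, ((drawAll fun i : Fin n => f i.succ).map fun t => (Fin.cons a t : Fin (n + 1) → α)) g
        = if a = g 0 then drawAll (fun i : Fin n => f i.succ) (Fin.tail g) else 0 := by
      intro a
      rw [PMF.map_apply]
      split_ifs with h
      · subst h
        rw [tsum_eq_single (Fin.tail g)]
        · simp
        · intro t ht
          rw [if_neg]
          intro e
          exact ht (by rw [e]; simp)
      · refine ENNReal.tsum_eq_zero.2 fun t => if_neg fun e => h ?_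
        rw [e]; simp
    rw [drawAll, PMF.bind_apply, tsum_eq_single (g 0), hmap, if_pos rfl, drawAll_apply,
      Fin.prod_univ_succ]
    · rfl
    · intro a ha
      rw [hmap, if_neg ha, mul_zero]

/-- Redrawing one coordinate does not change the law of independent draws. -/
theorem drawAll_bind_update {α : Type*} : ∀ {n : ℕ} (f : Fin n → PMF α) (i : Fin n),
    ((drawAll f).bind fun g => (f i).map fun a => Function.update g i a) = drawAll f
  | 0, _, i => i.elim0
  | n + 1, f, i => by
    simp only [drawAll, PMF.bind_bind, PMF.bind_map]
    refine Fin.cases ?_ (fun j => ?_) i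
    · simp only [Function.comp_def, Fin.update_cons_zero]
      rw [PMF.bind_const]
      simp only [← PMF.bind_pure_comp, Function.comp_def]
      exact PMF.bind_comm _ _ _
    · congr 1
      funext a
      conv_rhs => rw [← drawAll_bind_update (fun i : Fin n => f i.succ) j]
      simp only [PMF.map_bind, PMF.map_comp, Function.comp_def, Fin.cons_update]

theorem tsum_bind_mul {α β : Type*} (μ : PMF α) (q : α → PMF β) (G : β → ENNReal) :
    ∑' b, μ.bind q b * G b = ∑' a, μ a * ∑' b, q a b * G b := by
  simp only [PMF.bind_apply, ← ENNReal.tsum_mul_right, ← ENNReal.tsum_mul_left, mul_assoc]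
  exact ENNReal.tsum_comm

theorem tsum_map_mul {α β : Type*} (μ : PMF α) (h : α → β) (G : β → ENNReal) :
    ∑' b, μ.map h b * G b = ∑' a, μ a * G (h a) := by
  rw [← PMF.bind_pure_comp, tsum_bind_mul]
  congr 1
  funext a
  rw [tsum_eq_single (h a)]
  · simp
  · intro b hb
    simp [hb]

theorem tsum_drawAll_update {n : ℕ} {α : Type*} (f : Fin n → PMF α) (i : Fin n)
    (G : (Fin n → α) → ENNReal) :
    ∑' g, drawAll f g * ∑' a, f i a * G (Function.update g i a) = ∑' g, drawAll f g * G g := by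
  conv_rhs => rw [← drawAll_bind_update f i, tsum_bind_mul]
  simp only [tsum_map_mul]

/-! ### The stash process -/

/-- The address used by a phase of a query to `i`: uniformly random if the phase involves the
stash, and `i` otherwise. -/
noncomputable def address {n : ℕ} [NeZero n] (b : Bool) (i : Fin n) : PMF (Fin n) :=
  if b then PMF.uniformOfFintype (Fin n) else PMF.pure i

def load {n : ℕ} (S : Fin n → Bool) : ℕ := (Finset.univ.filter fun i => S i = true).card

/-- The addresses of the server operations and the client loads, as functions of the set of
stashed indices only. -/
noncomputable def stashRun {n : ℕ} [NeZero n] (p : unitInterval) :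
    (Fin n → Bool) → List (Fin n) → PMF (List (Fin n × Fin n) × List ℕ)
  | S, [] => PMF.pure ([], [load S + 3])
  | S, i :: xs => (address (S i) i).bind fun d => (coin p).bind fun r =>
      (address r i).bind fun o => (stashRun p (Function.update S i r) xs).map fun e =>
        ((d, o) :: e.1, (load S + 3) :: (load (Function.update S i false) + 3) :: e.2)

def State.stashed {n : ℕ} {Key Block Ct : Type*} (s : State n Key Block Ct) : Fin n → Bool :=
  fun i => (s.stash i).isSome

def requests {n : ℕ} (a : Fin n × Fin n) : List (ServerOp n) :=
  [ServerOp.download a.1, ServerOp.download a.2, ServerOp.upload a.2]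

theorem State.clientBlocks_eq {n : ℕ} {Key Block Ct : Type*} (s : State n Key Block Ct) :
    s.clientBlocks = load s.stashed + 3 := rfl

section Scheme

variable {n : ℕ} {Key Block Ct : Type*}

theorem State.stashed_mk_update (s : State n Key Block Ct) (k : Key) (A : Fin n → Ct) (i : Fin n)
    (b : Option Block) :
    (State.mk k (Function.update s.stash i b) A).stashed
      = Function.update s.stashed i b.isSome := by
  funext j
  by_cases h : j = i
  · subst h; simp [State.stashed]
  · simp [State.stashed, h]

theorem State.stashed_mk_stash (s : State n Key Block Ct) (k : Key) (A : Fin n → Ct) :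
    (State.mk k s.stash A).stashed = s.stashed := rfl

theorem map_setup (E : EncScheme Key Block Ct) (p : unitInterval) (D : Fin n → Block) :
    (setup E p D).map State.stashed = drawAll fun _ : Fin n => coin p := by
  unfold setup
  rw [PMF.map_bind]
  simp only [PMF.map_comp]
  have h : ∀ k, ((drawAll fun i : Fin n => (E.enc k (D i)).bind fun ct =>
      (coin p).map fun r => (ct, if r then some (D i) else none)).map
        (fun cells i => (cells i).2.isSome)) = drawAll fun _ : Fin n => coin p := by
    intro k
    rw [map_drawAll (fun c : Ct × Option Block => c.2.isSome)]
    congr 1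
    funext i
    simp only [PMF.map_bind, PMF.map_comp, Function.comp_def]
    have : (fun r : Bool => (if r then some (D i) else none).isSome) = id := by
      funext r; cases r <;> rfl
    simp only [this, PMF.map_id, PMF.bind_const]
  exact (congrArg _ (funext h)).trans (PMF.bind_const _ _)

variable [NeZero n]

/-- Both branches end with i outside the stash, which is why the continuation only has to be
understood on such states, and why a single update by `false` describes both. -/
theorem downloadPhase_bind {γ : Type*} (E : EncScheme Key Block Ct) (s : State n Key Block Ct)
    (i : Fin n) (G : State n Key Block Ct × Block × Fin n → PMF γ)
    (g : (Fin n → Bool) → Fin n → PMF γ)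
    (hG : ∀ x, x.1.stash i = none → G x = g x.1.stashed x.2.2) :
    (downloadPhase E s i).bind G
      = (address (s.stashed i) i).bind (g (Function.update s.stashed i false)) := by
  unfold downloadPhase
  cases h : s.stash i with
  | some B =>
    have hs : s.stashed i = true := by simp [State.stashed, h]
    simp only [hs, address, if_true, PMF.bind_map]
    congr 1
    funext d
    rw [Function.comp_apply, hG _ (by simp)]
    rw [State.stashed_mk_update, Option.isSome_none]
  | none =>
    have hs : s.stashed i = false := by simp [State.stashed, h]
    simp only [hs, address, Bool.false_eq_true, if_false, PMF.pure_bind]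
    rw [hG _ h, ← hs, Function.update_eq_self]

/-- The continuation ignores ciphertexts, so the encryption randomness integrates out. Since i
starts unstashed, the branch that leaves the stash alone is also an update by the coin. -/
theorem overwritePhase_bind {γ : Type*} (E : EncScheme Key Block Ct) (p : unitInterval)
    (s : State n Key Block Ct) (i : Fin n) (B : Block) (hs : s.stash i = none)
    (G : State n Key Block Ct × Fin n → PMF γ) (g : (Fin n → Bool) → Fin n → PMF γ)
    (hG : ∀ y, G y = g y.1.stashed y.2) :
    (overwritePhase E p s i B).bind G = (coin p).bind fun r =>
      (address r i).bind (g (Function.update s.stashed i r)) := by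
  unfold overwritePhase
  rw [PMF.bind_bind]
  congr 1
  funext r
  have hs' : s.stashed i = false := by simp [State.stashed, hs]
  cases r
  · simp only [Bool.false_eq_true, if_false, address, PMF.bind_map, Function.comp_def, hG,
      PMF.pure_bind]
    simp only [State.stashed_mk_stash]
    rw [← hs', Function.update_eq_self]
    exact PMF.bind_const _ _
  · simp only [if_true, address, PMF.bind_bind, PMF.bind_map, Function.comp_def, hG]
    congr 1
    funext o
    simp only [State.stashed_mk_update, Option.isSome_some]
    exact PMF.bind_const _ _

/-- The view and the loads depend on the contents through the set of stashed indices only. -/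
theorem map_run (E : EncScheme Key Block Ct) (p : unitInterval) :
    ∀ (xs : List (Query n × Block)) (s : State n Key Block Ct),
      (run E p s xs).map (fun e => (e.view, e.clientLoads))
        = (stashRun p s.stashed (xs.map fun x => x.1.1)).map
            (fun e => (e.1.map requests, e.2))
  | [], s => by simp [run, stashRun, PMF.pure_map, State.clientBlocks_eq]
  | x :: xs, s => by
    simp only [run, List.map_cons, stashRun, query, PMF.map_bind, PMF.bind_bind, PMF.bind_map]
    refine (downloadPhase_bind E s x.1.1 _ (fun S d => (coin p).bind fun r =>
      (address r x.1.1).bind fun o => ((stashRun p (Function.update S x.1.1 r)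
        (xs.map fun x => x.1.1)).map (fun e => (e.1.map requests, e.2))).map fun e =>
          (requests (d, o) :: e.1, (load s.stashed + 3) :: (load S + 3) :: e.2)) ?_).trans ?_
    · intro y hy
      refine overwritePhase_bind E p y.1 x.1.1 _ hy _ (fun S o => ((stashRun p S
        (xs.map fun x => x.1.1)).map (fun e => (e.1.map requests, e.2))).map fun e =>
          (requests (y.2.2, o) :: e.1,
            (load s.stashed + 3) :: (load y.1.stashed + 3) :: e.2)) ?_
      intro z
      rw [← map_run E p xs z.1, PMF.map_comp, Function.comp_apply, PMF.map_comp]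
      rfl
    · simp only [Function.update_idem, PMF.map_comp]
      rfl

theorem map_execute (E : EncScheme Key Block Ct) (p : unitInterval) (D : Fin n → Block) {l : ℕ}
    (Q : Fin l → Query n) (W : Fin l → Block) :
    (execute E p D Q W).map (fun e => (e.view, e.clientLoads))
      = ((drawAll fun _ : Fin n => coin p).bind fun S =>
          stashRun p S (List.ofFn fun j => (Q j).1)).map (fun e => (e.1.map requests, e.2)) := by
  rw [execute, PMF.map_bind, ← map_setup E p D, PMF.bind_map, PMF.map_bind]
  congr 1
  funext s
  simp only [map_run, inputs, List.map_ofFn, Function.comp_def]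

end Scheme

/-! ### Correctness and bandwidth -/

section Correctness

variable {n : ℕ} {Key Block Ct : Type*}

/-- The state represents the memory `mem`. -/
def State.Represents (E : EncScheme Key Block Ct) (s : State n Key Block Ct)
    (mem : Fin n → Block) : Prop :=
  s.key ∈ E.keyGen.support ∧
    ∀ i, (s.stash i).getD (E.dec s.key (s.server i)) = mem i

theorem mem_support_drawAll {α : Type*} {f : Fin n → PMF α} {g : Fin n → α}
    (h : g ∈ (drawAll f).support) (i : Fin n) : g i ∈ (f i).support := by
  rw [PMF.mem_support_iff, drawAll_apply, Finset.prod_ne_zero_iff] at h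
  exact (PMF.mem_support_iff _ _).2 (h i (Finset.mem_univ i))

theorem represents_of_mem_support_setup {E : EncScheme Key Block Ct} {p : unitInterval}
    {D : Fin n → Block} {s : State n Key Block Ct} (hs : s ∈ (setup E p D).support) :
    s.Represents E D := by
  simp only [setup, PMF.mem_support_bind_iff, PMF.mem_support_map_iff] at hs
  obtain ⟨k, hk, cells, hc, rfl⟩ := hs
  refine ⟨hk, fun i => ?_⟩
  have hi := mem_support_drawAll hc i
  simp only [PMF.mem_support_bind_iff, PMF.mem_support_map_iff] at hi
  obtain ⟨ct, hct, r, -, hr⟩ := hi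
  simp only [← hr]
  cases r
  · exact E.dec_enc k hk _ ct hct
  · rfl

variable [NeZero n]

/-- Between the two phases the representation may fail at i: the stashed copy is gone and the
server's copy may be stale. The current content of i then lives only in the returned block. -/
theorem downloadPhase_spec {E : EncScheme Key Block Ct} {s : State n Key Block Ct}
    {mem : Fin n → Block} (hs : s.Represents E mem) {i : Fin n}
    {x : State n Key Block Ct × Block × Fin n} (hx : x ∈ (downloadPhase E s i).support) :
    x.2.1 = mem i ∧ x.1.key ∈ E.keyGen.support ∧ x.1.stash i = none ∧
      ∀ j, j ≠ i → (x.1.stash j).getD (E.dec x.1.key (x.1.server j)) = mem j := by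
  have hi := hs.2 i
  unfold downloadPhase at hx
  cases h : s.stash i with
  | some B =>
    simp only [h, PMF.mem_support_map_iff] at hx
    obtain ⟨d, -, rfl⟩ := hx
    refine ⟨by simpa [h] using hi, hs.1, by simp, fun j hj => ?_⟩
    simpa [hj] using hs.2 j
  | none =>
    simp only [h, PMF.mem_support_pure_iff] at hx
    subst hx
    exact ⟨by simpa [h] using hi, hs.1, h, fun j _ => hs.2 j⟩

theorem overwritePhase_spec {E : EncScheme Key Block Ct} {p : unitInterval}
    {s : State n Key Block Ct} {mem : Fin n → Block} {i : Fin n} {B : Block}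
    (hk : s.key ∈ E.keyGen.support) (hi : s.stash i = none)
    (hs : ∀ j, j ≠ i → (s.stash j).getD (E.dec s.key (s.server j)) = mem j)
    {y : State n Key Block Ct × Fin n} (hy : y ∈ (overwritePhase E p s i B).support) :
    y.1.Represents E (Function.update mem i B) := by
  simp only [overwritePhase, PMF.mem_support_bind_iff] at hy
  obtain ⟨r, -, hy⟩ := hy
  cases r
  · simp only [Bool.false_eq_true, if_false, PMF.mem_support_map_iff] at hy
    obtain ⟨ct, hct, rfl⟩ := hy
    refine ⟨hk, fun j => ?_⟩
    by_cases hj : j = i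
    · subst hj
      simpa [hi] using E.dec_enc _ hk _ _ hct
    · simpa [hj] using hs j hj
  · simp only [if_true, PMF.mem_support_bind_iff, PMF.mem_support_map_iff] at hy
    obtain ⟨o, -, ct, hct, rfl⟩ := hy
    refine ⟨hk, fun j => ?_⟩
    by_cases hj : j = i
    · subst hj; simp
    -- Re-encryption preserves the plaintext stored at `o`, stale or not, so the case `j = o` needs
    -- no special treatment.
    · have hdec : E.dec s.key (Function.update s.server o ct j) = E.dec s.key (s.server j) := by
        by_cases hjo : j = o
        · subst hjo
          simpa using E.dec_enc _ hk _ _ hct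
        · simp [hjo]
      simpa [hj, hdec] using hs j hj

theorem run_spec {E : EncScheme Key Block Ct} {p : unitInterval} :
    ∀ (xs : List (Query n × Block)) {s : State n Key Block Ct} {mem : Fin n → Block},
      s.Represents E mem → ∀ e ∈ (run E p s xs).support,
        e.answers = plainAnswers mem xs ∧ e.view.length = xs.length ∧
          ∀ ops ∈ e.view, ∃ a, ops = requests a
  | [], s, mem, _, e, he => by
    simp only [run, PMF.mem_support_pure_iff] at he
    subst he
    simp [plainAnswers]
  | ((i, op), b) :: xs, s, mem, hs, e, he => by
    simp only [run, query, PMF.mem_support_bind_iff, PMF.mem_support_map_iff] at he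
    obtain ⟨r, ⟨x, hx, y, hy, rfl⟩, e', he', rfl⟩ := he
    obtain ⟨hB, hk, hi, hrest⟩ := downloadPhase_spec hs hx
    obtain ⟨h1, h2, h3⟩ := run_spec xs (overwritePhase_spec hk hi hrest hy) e' he'
    refine ⟨?_, by simpa using h2, ?_⟩
    · cases op
      -- A read writes back the content it found, so the represented memory does not change.
      · simp only at h1
        rw [hB, Function.update_eq_self] at h1
        simp only [plainAnswers, h1, hB]
      · simp only [plainAnswers, h1]
    · intro ops hops
      rcases List.mem_cons.1 hops with rfl | hops
      · exact ⟨(x.2.2, y.2), rfl⟩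
      · exact h3 ops hops

end Correctness

/-! ### Privacy -/

section Privacy

variable {n : ℕ} [NeZero n]

/-- The law of the addresses seen by the server, from a given set of stashed indices. -/
noncomputable def viewLaw (p : unitInterval) (xs : List (Fin n)) (S : Fin n → Bool) :
    PMF (List (Fin n × Fin n)) :=
  (stashRun p S xs).map Prod.fst

/-- The weight of answering a query to `i` by the addresses `d` and `o`, if `f` is the weight of
the continuation. -/
noncomputable def stepWeight (p : unitInterval) (i d o : Fin n) (f : (Fin n → Bool) → ENNReal)
    (S : Fin n → Bool) : ENNReal :=
  address (S i) i d * ∑' r, coin p r * (address r i o * f (Function.update S i r))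

theorem map_cons_apply {α : Type*} (μ : PMF (List α)) (a b : α) (v : List α) [Decidable (b = a)] :
    (μ.map (List.cons a)) (b :: v) = if b = a then μ v else 0 := by
  rw [PMF.map_apply]
  split_ifs with h
  · rw [tsum_eq_single v]
    · simp [h]
    · intro w hw
      exact if_neg fun e => hw (List.cons.inj e).2.symm
  · exact ENNReal.tsum_eq_zero.2 fun w => if_neg fun e => h (List.cons.inj e).1

theorem viewLaw_cons (p : unitInterval) (i : Fin n) (xs : List (Fin n)) (S : Fin n → Bool) :
    viewLaw p (i :: xs) S = (address (S i) i).bind fun d => (coin p).bind fun r =>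
      (address r i).bind fun o =>
        (viewLaw p xs (Function.update S i r)).map (List.cons (d, o)) := by
  simp only [viewLaw, stashRun, PMF.map_bind, PMF.map_comp]
  rfl

theorem viewLaw_cons_cons (p : unitInterval) (i d o : Fin n) (xs : List (Fin n))
    (v : List (Fin n × Fin n)) (S : Fin n → Bool) :
    viewLaw p (i :: xs) S ((d, o) :: v) = stepWeight p i d o (fun S => viewLaw p xs S v) S := by
  classical
  rw [viewLaw_cons, PMF.bind_apply, tsum_eq_single d, stepWeight, PMF.bind_apply]
  · congr 2
    funext r
    rw [PMF.bind_apply, tsum_eq_single o, map_cons_apply, if_pos rfl]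
    intro o' ho
    rw [map_cons_apply, if_neg (by simpa using ho.symm), mul_zero]
  · intro d' hd
    have : ∀ r o', ((viewLaw p xs (Function.update S i r)).map (List.cons (d', o'))) ((d, o) :: v)
        = 0 := fun r o' => by
      rw [map_cons_apply, if_neg (by simp [hd.symm])]
    simp [PMF.bind_apply, this]

theorem length_of_mem_support_viewLaw (p : unitInterval) :
    ∀ (xs : List (Fin n)) (S : Fin n → Bool) (v : List (Fin n × Fin n)),
      v ∈ (viewLaw p xs S).support → v.length = xs.length
  | [], S, v, hv => by
    simp only [viewLaw, stashRun, PMF.pure_map, PMF.mem_support_pure_iff] at hv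
    simp [hv]
  | i :: xs, S, v, hv => by
    simp only [viewLaw_cons, PMF.mem_support_bind_iff, PMF.mem_support_map_iff] at hv
    obtain ⟨d, -, r, -, o, -, w, hw, rfl⟩ := hv
    simp [length_of_mem_support_viewLaw p xs _ w hw]

theorem stepWeight_le_of_le {p : unitInterval} {i d o : Fin n} {f : (Fin n → Bool) → ENNReal}
    {S : Fin n → Bool} {M : ENNReal} (h : ∀ r, f (Function.update S i r) ≤ M) :
    stepWeight p i d o f S ≤ address (S i) i d * M := by
  refine mul_le_mul_right (?_ : _ ≤ M) _
  calc ∑' r, coin p r * (address r i o * f (Function.update S i r))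
      ≤ ∑' r, coin p r * M := ENNReal.tsum_le_tsum fun r => mul_le_mul_right
        ((mul_le_mul' (PMF.coe_le_one _ _) (h r)).trans_eq (one_mul _)) _
    _ = M := by rw [ENNReal.tsum_mul_right, PMF.tsum_coe, one_mul]

/-- Keep only the branch in which i is stashed again: there every address o has probability 1/n,
whatever o is. -/
theorem le_stepWeight (p : unitInterval) (i d o : Fin n) (f : (Fin n → Bool) → ENNReal)
    (S : Fin n → Bool) :
    address (S i) i d * (coin p true * (n : ENNReal)⁻¹ * f (Function.update S i true))
      ≤ stepWeight p i d o f S := by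
  refine mul_le_mul_right ?_ _
  refine le_trans (le_of_eq ?_) (ENNReal.le_tsum true)
  simp [address, mul_assoc]

theorem stepWeight_mono {p : unitInterval} {i d o : Fin n} {f g : (Fin n → Bool) → ENNReal}
    {C : ENNReal} (h : ∀ S, f S ≤ C * g S) (S : Fin n → Bool) :
    stepWeight p i d o f S ≤ C * stepWeight p i d o g S := by
  unfold stepWeight
  rw [mul_left_comm]
  refine mul_le_mul_right ?_ _
  rw [← ENNReal.tsum_mul_left]
  refine ENNReal.tsum_le_tsum fun r => ?_
  rw [mul_left_comm C, mul_left_comm C]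
  gcongr
  exact h _

/-- `f` is bounded by `C * g` evaluated with `i` stashed. -/
def Dominated (i : Fin n) (C : ENNReal) (f g : (Fin n → Bool) → ENNReal) : Prop :=
  ∀ S, f S ≤ C * g (Function.update S i true)

theorem Dominated.stepWeight_of_ne {p : unitInterval} {i x d o : Fin n} {C : ENNReal}
    {f g : (Fin n → Bool) → ENNReal} (h : Dominated i C f g) (hx : x ≠ i) :
    Dominated i C (stepWeight p x d o f) (stepWeight p x d o g) := by
  intro S
  unfold stepWeight
  rw [mul_left_comm, Function.update_of_ne hx]
  refine mul_le_mul_right ?_ _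
  rw [← ENNReal.tsum_mul_left]
  refine ENNReal.tsum_le_tsum fun r => ?_
  rw [mul_left_comm C, mul_left_comm C, Function.update_comm hx.symm]
  gcongr
  exact h _

/-- A query to i may itself stash i, with weight p/n for the required address. At the cost of κ ≥
n/p this removes the proviso that i be stashed and leaves a comparison at the same S. -/
theorem Dominated.stepWeight_self {p : unitInterval} {i d o : Fin n} {C κ : ENNReal}
    (hκ : 1 ≤ κ * (coin p true * (n : ENNReal)⁻¹))
    {f g : (Fin n → Bool) → ENNReal} (h : Dominated i C f g) (S : Fin n → Bool) :
    stepWeight p i d o f S ≤ C * κ * stepWeight p i d o g S := by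
  calc stepWeight p i d o f S
      ≤ address (S i) i d * (C * g (Function.update S i true)) :=
        stepWeight_le_of_le fun r => by simpa using h (Function.update S i r)
    _ ≤ address (S i) i d * (C * g (Function.update S i true))
          * (κ * (coin p true * (n : ENNReal)⁻¹)) := le_mul_of_one_le_right' hκ
    _ = C * κ * (address (S i) i d
          * (coin p true * (n : ENNReal)⁻¹ * g (Function.update S i true))) := by ring
    _ ≤ _ := mul_le_mul_right (le_stepWeight p i d o g S) _

theorem one_eq_card_mul_inv : (1 : ENNReal) = n * (n : ENNReal)⁻¹ :=
  (ENNReal.mul_inv_cancel (by simp [NeZero.ne n]) (ENNReal.natCast_ne_top n)).symm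

/-- Queries to other indices do not see whether i is stashed. At the first query to i the download
has probability 1/n on the right and at most 1 on the left, and the rest coincides because
coordinate i is overwritten. -/
theorem dominated_viewLaw (p : unitInterval) (i : Fin n) :
    ∀ (xs : List (Fin n)) (v : List (Fin n × Fin n)),
      Dominated i n (fun S => viewLaw p xs S v) (fun S => viewLaw p xs S v)
  | [], v => fun S => by
    simp only [viewLaw, stashRun, PMF.pure_map]
    exact le_mul_of_one_le_left' (by exact_mod_cast NeZero.one_le)
  | x :: xs, [] => fun S => by
    have : viewLaw p (x :: xs) S [] = 0 := by
      by_contra h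
      simpa using length_of_mem_support_viewLaw p _ _ _ ((PMF.mem_support_iff _ _).2 h)
    simp [this]
  | x :: xs, (d, o) :: v => by
    simp only [viewLaw_cons_cons]
    by_cases hx : x = i
    · subst hx
      intro S
      simp only [stepWeight, Function.update_idem, Function.update_self]
      rw [← mul_assoc]
      refine mul_le_mul_left ?_ _
      have h : address true x d = (n : ENNReal)⁻¹ := by simp [address]
      rw [h, ← one_eq_card_mul_inv]
      exact PMF.coe_le_one _ _
    · exact (dominated_viewLaw p i xs v).stepWeight_of_ne hx

/-- Inserting a query to `i`. -/
theorem dominated_cons (p : unitInterval) (i d o : Fin n) (xs : List (Fin n))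
    (v : List (Fin n × Fin n)) :
    Dominated i n (fun S => viewLaw p (i :: xs) S ((d, o) :: v)) (fun S => viewLaw p xs S v) := by
  intro S
  simp only [viewLaw_cons_cons]
  refine (stepWeight_le_of_le (M := n * viewLaw p xs (Function.update S i true) v)
    fun r => ?_).trans (mul_le_of_le_one_left' (PMF.coe_le_one _ _))
  simpa using dominated_viewLaw p i xs v (Function.update S i r)

/-- Deleting a query to `i`. -/
theorem dominated_of_cons {p : unitInterval} {κ : ENNReal}
    (hκ : 1 ≤ κ * (coin p true * (n : ENNReal)⁻¹)) (i d o : Fin n) (xs : List (Fin n))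
    (v : List (Fin n × Fin n)) :
    Dominated i (n * n * κ) (fun S => viewLaw p xs S v)
      (fun S => viewLaw p (i :: xs) S ((d, o) :: v)) := by
  intro S
  simp only [viewLaw_cons_cons]
  have h := le_stepWeight p i d o (fun S => viewLaw p xs S v) (Function.update S i true)
  simp only [Function.update_self, Function.update_idem] at h
  have ha : address true i d = (n : ENNReal)⁻¹ := by simp [address]
  rw [ha] at h
  -- One factor n stashes i, the second pays for the uniform download of d, and κ pays for stashing
  -- i again with overwritten address o.
  calc viewLaw p xs S v
      ≤ n * viewLaw p xs (Function.update S i true) v := dominated_viewLaw p i xs v S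
    _ ≤ n * viewLaw p xs (Function.update S i true) v
          * (n * (n : ENNReal)⁻¹ * (κ * (coin p true * (n : ENNReal)⁻¹))) := by
        rw [← one_eq_card_mul_inv, one_mul]
        exact le_mul_of_one_le_right' hκ
    _ = n * n * κ * ((n : ENNReal)⁻¹ * (coin p true * (n : ENNReal)⁻¹
          * viewLaw p xs (Function.update S i true) v)) := by ring
    _ ≤ _ := mul_le_mul_right h _

/-- Going backwards through the prefix, domination survives until a query to i is met. That query
turns it into a pointwise bound, which every earlier step preserves, so κ is paid at most once. -/
theorem dominated_or_le_append {p : unitInterval} {κ C : ENNReal}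
    (hκ : 1 ≤ κ * (coin p true * (n : ENNReal)⁻¹)) {i : Fin n} {xs ys : List (Fin n)}
    {v w : List (Fin n × Fin n)}
    (h : Dominated i C (fun S => viewLaw p xs S v) (fun S => viewLaw p ys S w)) :
    ∀ (zs : List (Fin n)) (u : List (Fin n × Fin n)), u.length = zs.length →
      Dominated i C (fun S => viewLaw p (zs ++ xs) S (u ++ v))
          (fun S => viewLaw p (zs ++ ys) S (u ++ w)) ∨
        ∀ S, viewLaw p (zs ++ xs) S (u ++ v) ≤ C * κ * viewLaw p (zs ++ ys) S (u ++ w)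
  | [], [], _ => Or.inl h
  | z :: zs, (d, o) :: u, hlen => by
    simp only [List.cons_append, viewLaw_cons_cons]
    rcases dominated_or_le_append hκ h zs u (by simpa using hlen) with h' | h'
    · by_cases hz : z = i
      · subst hz
        exact Or.inr (h'.stepWeight_self hκ)
      · exact Or.inl (h'.stepWeight_of_ne hz)
    · exact Or.inr (stepWeight_mono h')

/-- If the prefix never queried i, setup does the job: resampling coordinate i under the product law
stashes i with probability p ≥ 1/κ. -/
theorem tsum_drawAll_le_of_dominated {p : unitInterval} {κ C : ENNReal}
    (hκ : 1 ≤ κ * (coin p true * (n : ENNReal)⁻¹)) {i : Fin n}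
    {f g : (Fin n → Bool) → ENNReal} (h : Dominated i C f g ∨ ∀ S, f S ≤ C * κ * g S) :
    ∑' S, drawAll (fun _ : Fin n => coin p) S * f S
      ≤ C * κ * ∑' S, drawAll (fun _ : Fin n => coin p) S * g S := by
  rcases h with h | h
  · rw [← tsum_drawAll_update _ i f, ← tsum_drawAll_update _ i g, ← ENNReal.tsum_mul_left]
    have hn : (n : ENNReal)⁻¹ ≤ 1 := ENNReal.inv_le_one.2 (by exact_mod_cast NeZero.one_le)
    have hp : 1 ≤ κ * coin p true := hκ.trans (by
      gcongr
      exact mul_le_of_le_one_right' hn)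
    refine ENNReal.tsum_le_tsum fun S => ?_
    rw [mul_left_comm]
    gcongr
    calc ∑' r, coin p r * f (Function.update S i r)
        ≤ ∑' r, coin p r * (C * g (Function.update S i true)) := by
          gcongr with r
          simpa using h (Function.update S i r)
      _ = C * g (Function.update S i true) := by
          rw [ENNReal.tsum_mul_right, PMF.tsum_coe, one_mul]
      _ ≤ C * g (Function.update S i true) * (κ * coin p true) := le_mul_of_one_le_right' hp
      _ = C * κ * (coin p true * g (Function.update S i true)) := by ring
      _ ≤ _ := by
          gcongr
          exact ENNReal.le_tsum (f := fun r => coin p r * g (Function.update S i r)) true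
  · rw [← ENNReal.tsum_mul_left]
    refine ENNReal.tsum_le_tsum fun S => ?_
    rw [mul_left_comm]
    gcongr
    exact h S

/-- The intermediate term omits the query and its entry (d, o) from both lists. Removing a costs n ·
κ and inserting b costs n²κ · κ. -/
theorem viewLaw_append_cons_le {p : unitInterval} {κ : ENNReal}
    (hκ : 1 ≤ κ * (coin p true * (n : ENNReal)⁻¹)) (zs xs : List (Fin n)) (a b : Fin n)
    (v : List (Fin n × Fin n)) :
    (drawAll fun _ : Fin n => coin p).bind (viewLaw p (zs ++ a :: xs)) v
      ≤ n ^ 3 * κ ^ 3 * (drawAll fun _ : Fin n => coin p).bind (viewLaw p (zs ++ b :: xs)) v := by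
  by_cases hlen : v.length = (zs ++ a :: xs).length
  · obtain ⟨u, w, rfl, hu⟩ : ∃ u w, v = u ++ w ∧ u.length = zs.length :=
      ⟨v.take zs.length, v.drop zs.length, (List.take_append_drop _ _).symm, by
        simp at hlen ⊢; omega⟩
    obtain ⟨⟨d, o⟩, w, rfl⟩ : ∃ c w', w = c :: w' :=
      List.exists_cons_of_length_pos (by simp at hlen; omega)
    simp only [PMF.bind_apply]
    calc _ ≤ _ := tsum_drawAll_le_of_dominated hκ
            (dominated_or_le_append hκ (dominated_cons p a d o xs w) zs u hu)
      _ ≤ _ := mul_le_mul_right (tsum_drawAll_le_of_dominated hκ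
            (dominated_or_le_append hκ (dominated_of_cons hκ b d o xs w) zs u hu)) _
      _ = _ := by ring
  · rw [PMF.bind_apply, ENNReal.tsum_eq_zero.2]
    · exact zero_le
    · intro S
      have : viewLaw p (zs ++ a :: xs) S v = 0 := by
        by_contra h
        exact hlen (length_of_mem_support_viewLaw p _ _ _ ((PMF.mem_support_iff _ _).2 h))
      rw [this, mul_zero]

theorem exists_ofFn_eq_append_cons {α : Type*} : ∀ {l : ℕ} (f g : Fin l → α) (j : Fin l),
    (∀ i, i ≠ j → f i = g i) → ∃ zs a b xs,
      List.ofFn f = zs ++ a :: xs ∧ List.ofFn g = zs ++ b :: xs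
  | 0, _, _, j, _ => j.elim0
  | l + 1, f, g, j, h => by
    simp only [List.ofFn_succ]
    induction j using Fin.cases with
    | zero =>
      refine ⟨[], f 0, g 0, List.ofFn fun i => f i.succ, rfl, ?_⟩
      have : (fun i : Fin l => f i.succ) = fun i => g i.succ :=
        funext fun i => h _ (Fin.succ_ne_zero i)
      simp [this]
    | succ j =>
      obtain ⟨zs, a, b, xs, h1, h2⟩ := exists_ofFn_eq_append_cons (fun i => f i.succ)
        (fun i => g i.succ) j fun i hi => h _ fun e => hi (Fin.succ_injective _ e)
      exact ⟨f 0 :: zs, a, b, xs, by simp [h1], by simp [h2, h 0 (Fin.succ_ne_zero j).symm]⟩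

theorem toOuterMeasure_le_of_le {α : Type*} {μ ν : PMF α} {C : ENNReal}
    (h : ∀ a, μ a ≤ C * ν a) (T : Set α) : μ.toOuterMeasure T ≤ C * ν.toOuterMeasure T := by
  classical
  rw [PMF.toOuterMeasure_apply, PMF.toOuterMeasure_apply, ← ENNReal.tsum_mul_left]
  refine ENNReal.tsum_le_tsum fun a => ?_
  by_cases ha : a ∈ T
  · simpa [ha] using h a
  · simp [ha]

variable {Key Block Ct : Type*}

theorem map_view_execute (E : EncScheme Key Block Ct) (p : unitInterval) (D : Fin n → Block)
    {l : ℕ} (Q : Fin l → Query n) (W : Fin l → Block) :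
    (execute E p D Q W).map Execution.view
      = ((drawAll fun _ : Fin n => coin p).bind
          (viewLaw p (List.ofFn fun j => (Q j).1))).map (List.map requests) := by
  have h := congrArg (PMF.map Prod.fst) (map_execute E p D Q W)
  rw [PMF.map_comp, PMF.map_comp] at h
  refine h.trans ?_
  simp only [PMF.map_bind, viewLaw, PMF.map_comp]
  rfl

theorem isDPAccess_execute (k : ℕ) (p : unitInterval) (hp : 1 / (n : ℝ) ^ k ≤ p)
    (E : EncScheme Key Block Ct) (D : Fin n → Block)
    (W : ∀ l : ℕ, (Fin l → Query n) → Fin l → Block) :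
    IsDPAccess (fun l Q => (execute E p D Q (W l Q)).map Execution.view)
      ((6 + 3 * k : ℕ) * Real.log n) 0 := by
  intro l Q₁ Q₂ hQ T
  have hn : (0 : ℝ) < n := by exact_mod_cast Nat.pos_of_ne_zero (NeZero.ne n)
  have hn0 : (n : ENNReal) ≠ 0 := by simp [NeZero.ne n]
  have hnt : (n : ENNReal) ≠ ⊤ := ENNReal.natCast_ne_top n
  -- Here κ = n^(k+1), so the total loss n³κ³ is n^(6+3k).
  have hexp : ENNReal.ofReal (Real.exp ((6 + 3 * k : ℕ) * Real.log n))
      = n ^ 3 * ((n : ENNReal) ^ (k + 1)) ^ 3 := by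
    rw [Real.exp_nat_mul, Real.exp_log hn, ENNReal.ofReal_pow hn.le, ENNReal.ofReal_natCast]
    ring
  have hκ : 1 ≤ (n : ENNReal) ^ (k + 1) * (coin p true * (n : ENNReal)⁻¹) := by
    have h1 : ENNReal.ofReal (1 / (n : ℝ) ^ k) ≤ coin p true := by
      simpa [coin] using ENNReal.ofReal_le_ofReal hp
    rw [ENNReal.ofReal_div_of_pos (by positivity), ENNReal.ofReal_one,
      ENNReal.ofReal_pow hn.le, ENNReal.ofReal_natCast, one_div] at h1
    calc (1 : ENNReal) = n ^ k * ((n : ENNReal) ^ k)⁻¹ * (n * (n : ENNReal)⁻¹) := by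
          rw [ENNReal.mul_inv_cancel (pow_ne_zero _ hn0) (ENNReal.pow_ne_top hnt),
            ENNReal.mul_inv_cancel hn0 hnt, one_mul]
      _ ≤ n ^ k * coin p true * (n * (n : ENNReal)⁻¹) := by gcongr
      _ = _ := by ring
  obtain ⟨j, hj⟩ := Finset.card_eq_one.1 hQ
  obtain ⟨zs, a, b, xs, h1, h2⟩ := exists_ofFn_eq_append_cons (fun i => (Q₁ i).1)
    (fun i => (Q₂ i).1) j fun i hi => by
      by_contra hne
      have : i ∈ ({j} : Finset (Fin l)) := by
        rw [← hj]
        simpa using fun e => hne (by rw [e])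
      exact hi (by simpa using this)
  rw [ENNReal.ofReal_zero, add_zero, hexp]
  simp only [map_view_execute, PMF.toOuterMeasure_map_apply, h1, h2]
  exact toOuterMeasure_le_of_le (viewLaw_append_cons_le hκ zs xs a b) _

end Privacy

/-! ### Client storage -/

section Storage

variable {n : ℕ}

theorem load_update_false_le (S : Fin n → Bool) (i : Fin n) :
    load (Function.update S i false) ≤ load S := by
  refine Finset.card_le_card fun j hj => ?_
  by_cases h : j = i
  · subst h; simp at hj
  · simpa [h] using hj

variable [NeZero n]

/-- The load after the download phase never exceeds the load before it, so only the times between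
queries enter the union bound. -/
theorem stashRun_cons_toOuterMeasure_le (p : unitInterval) (t : ℝ) (i : Fin n)
    (xs : List (Fin n)) (S : Fin n → Bool) :
    (stashRun p S (i :: xs)).toOuterMeasure {e | ∃ m ∈ e.2, t < (m : ℝ)}
      ≤ {S : Fin n → Bool | t < (load S + 3 : ℕ)}.indicator 1 S
        + ∑' r, coin p r * (stashRun p (Function.update S i r) xs).toOuterMeasure
            {e | ∃ m ∈ e.2, t < (m : ℝ)} := by
  by_cases hS : t < (load S + 3 : ℕ)
  · rw [Set.indicator_of_mem (by exact hS)]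
    refine le_trans ?_ le_self_add
    rw [PMF.toOuterMeasure_apply, Pi.one_apply,
      ← (stashRun p S (i :: xs)).tsum_coe]
    exact ENNReal.tsum_le_tsum fun e => Set.indicator_le_self _ _ _
  · have hS' : ¬ t < (load (Function.update S i false) + 3 : ℕ) := fun h => hS (h.trans_le (by
      exact_mod_cast Nat.add_le_add_right (load_update_false_le S i) 3))
    have hpre : ∀ d o : Fin n, (fun e : List (Fin n × Fin n) × List ℕ => ((d, o) :: e.1,
        (load S + 3) :: (load (Function.update S i false) + 3) :: e.2)) ⁻¹'
          {e | ∃ m ∈ e.2, t < (m : ℝ)}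
            = {e : List (Fin n × Fin n) × List ℕ | ∃ m ∈ e.2, t < (m : ℝ)} := by
      intro d o
      ext e
      simp only [Set.mem_preimage, Set.mem_ofPred_eq, List.exists_mem_cons_iff, hS, hS',
        false_or]
    rw [Set.indicator_of_notMem (by exact hS), zero_add]
    simp only [stashRun, PMF.toOuterMeasure_bind_apply, PMF.toOuterMeasure_map_apply, hpre,
      ENNReal.tsum_mul_right, PMF.tsum_coe, one_mul]
    exact le_rfl

/-- After the first query the stash has the initial law again, by resampling coordinate i. The
induction hypothesis therefore applies unchanged, and each query adds one copy of the initial tail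
probability. -/
theorem stashRun_toOuterMeasure_le (p : unitInterval) (t : ℝ) : ∀ xs : List (Fin n),
    ((drawAll fun _ : Fin n => coin p).bind fun S => stashRun p S xs).toOuterMeasure
        {e | ∃ m ∈ e.2, t < (m : ℝ)}
      ≤ (xs.length + 1) * (drawAll fun _ : Fin n => coin p).toOuterMeasure
          {S | t < (load S + 3 : ℕ)}
  | [] => by
    simp only [stashRun, List.length_nil, Nat.cast_zero, zero_add, one_mul]
    rw [← Function.comp_def PMF.pure, PMF.bind_pure_comp, PMF.toOuterMeasure_map_apply]
    refine le_of_eq (congrArg _ ?_)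
    ext S
    simp
  | i :: xs => by
    have ih := stashRun_toOuterMeasure_le p t xs
    rw [PMF.toOuterMeasure_bind_apply] at ih ⊢
    rw [← tsum_drawAll_update _ i] at ih
    calc _ ≤ ∑' S, ((drawAll fun _ : Fin n => coin p) S
              * {S : Fin n → Bool | t < (load S + 3 : ℕ)}.indicator 1 S
            + (drawAll fun _ : Fin n => coin p) S
              * ∑' r, coin p r * (stashRun p (Function.update S i r) xs).toOuterMeasure
                {e | ∃ m ∈ e.2, t < (m : ℝ)}) := ENNReal.tsum_le_tsum fun S => by
          rw [← mul_add]
          gcongr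
          exact stashRun_cons_toOuterMeasure_le p t i xs S
      _ ≤ (drawAll fun _ : Fin n => coin p).toOuterMeasure {S | t < (load S + 3 : ℕ)}
            + (xs.length + 1) * (drawAll fun _ : Fin n => coin p).toOuterMeasure
              {S | t < (load S + 3 : ℕ)} := by
          rw [ENNReal.tsum_add]
          refine add_le_add (le_of_eq ?_) ih
          rw [PMF.toOuterMeasure_apply]
          congr 1
          funext S
          by_cases hS : S ∈ {S : Fin n → Bool | t < (load S + 3 : ℕ)} <;> simp only [hS, Set.indicator_of_mem,
            Set.indicator_of_notMem, not_false_eq_true, Pi.one_apply, mul_one, mul_zero]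
      _ = _ := by
          rw [List.length_cons]
          push_cast
          ring

omit [NeZero n] in
-- The generating function of the load factors over the independent coordinates.
theorem tsum_drawAll_mul_pow_load (p : unitInterval) (a : ENNReal) :
    ∑' S, drawAll (fun _ : Fin n => coin p) S * a ^ load S
      = (coin p true * a + coin p false) ^ n := by
  have h : ∀ S : Fin n → Bool, drawAll (fun _ : Fin n => coin p) S * a ^ load S
      = ∏ i, coin p (S i) * (if S i = true then a else 1) := by
    intro S
    rw [drawAll_apply, Finset.prod_mul_distrib, Finset.prod_ite]
    simp [load]
  simp only [h]
  have h2 := Finset.prod_univ_sum (fun _ : Fin n => (Finset.univ : Finset Bool))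
    (fun _ b => coin p b * (if b = true then a else 1))
  rw [Fintype.piFinset_univ] at h2
  rw [tsum_fintype, ← h2]
  simp

omit [NeZero n] in
/-- A Chernoff bound for the size of the stash. -/
theorem drawAll_toOuterMeasure_load_le (p : unitInterval) (t : ℝ) :
    (drawAll fun _ : Fin n => coin p).toOuterMeasure {S | t < (load S + 3 : ℕ)}
      ≤ ENNReal.ofReal (Real.exp (3 + 2 * (n * p) - t)) := by
  have hp0 : (0 : ℝ) ≤ p := p.2.1
  have hp1 : (0 : ℝ) ≤ 1 - p := sub_nonneg.2 p.2.2
  have hmgf : coin p true * ENNReal.ofReal (Real.exp 1) + coin p false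
      ≤ ENNReal.ofReal (Real.exp (2 * p)) := by
    simp only [coin, PMF.ofFintype_apply, cond_true, cond_false]
    rw [← ENNReal.ofReal_mul hp0, ← ENNReal.ofReal_add (by positivity) hp1]
    refine ENNReal.ofReal_le_ofReal ?_
    -- Since e < 3, one has pe + 1 - p ≤ 1 + 2p ≤ exp(2p).
    have h1 := Real.add_one_le_exp (2 * (p : ℝ))
    have h2 := Real.exp_one_lt_d9
    nlinarith
  calc (drawAll fun _ : Fin n => coin p).toOuterMeasure {S | t < (load S + 3 : ℕ)}
      ≤ ∑' S, ENNReal.ofReal (Real.exp (3 - t)) * (drawAll (fun _ : Fin n => coin p) S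
          * ENNReal.ofReal (Real.exp 1) ^ load S) := by
        rw [PMF.toOuterMeasure_apply]
        refine ENNReal.tsum_le_tsum fun S => ?_
        by_cases hS : t < (load S + 3 : ℕ)
        · rw [Set.indicator_of_mem (by exact hS), mul_left_comm]
          -- Markov's inequality for exp(load): on the event, exp(3 - t + load) ≥ 1.
          refine le_mul_of_one_le_right' ?_
          rw [← ENNReal.ofReal_pow (Real.exp_pos 1).le, ← ENNReal.ofReal_mul (Real.exp_pos _).le,
            ← Real.exp_nat_mul, ← Real.exp_add, ENNReal.one_le_ofReal, Real.one_le_exp_iff]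
          push_cast at hS
          linarith
        · rw [Set.indicator_of_notMem (by exact hS)]
          exact zero_le
    _ ≤ ENNReal.ofReal (Real.exp (3 - t)) * ENNReal.ofReal (Real.exp (2 * p)) ^ n := by
        rw [ENNReal.tsum_mul_left, tsum_drawAll_mul_pow_load]
        gcongr
    _ = _ := by
        rw [← ENNReal.ofReal_pow (Real.exp_pos _).le, ← ENNReal.ofReal_mul (Real.exp_pos _).le,
          ← Real.exp_nat_mul, ← Real.exp_add]
        congr 2
        ring

variable {Key Block Ct : Type*}

theorem execute_toOuterMeasure_load_le (E : EncScheme Key Block Ct) (p : unitInterval)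
    (D : Fin n → Block) {l : ℕ} (Q : Fin l → Query n) (W : Fin l → Block) (t : ℝ) :
    (execute E p D Q W).toOuterMeasure {e | ∃ m ∈ e.clientLoads, t < (m : ℝ)}
      ≤ ENNReal.ofReal ((l + 1) * Real.exp (3 + 2 * (n * p) - t)) := by
  have h := congrArg (PMF.map Prod.snd) (map_execute E p D Q W)
  rw [PMF.map_comp, PMF.map_comp] at h
  have h2 := congrArg (fun μ => PMF.toOuterMeasure μ {ms : List ℕ | ∃ m ∈ ms, t < (m : ℝ)}) h
  simp only [PMF.toOuterMeasure_map_apply] at h2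
  refine h2.trans_le ((stashRun_toOuterMeasure_le p t _).trans ?_)
  rw [List.length_ofFn, ENNReal.ofReal_mul (by positivity),
    ENNReal.ofReal_add (by positivity) zero_le_one, ENNReal.ofReal_natCast, ENNReal.ofReal_one]
  gcongr
  exact drawAll_toOuterMeasure_load_le p t

end Storage

/-- The absolute value appears because the little-o hypothesis controls only |c n|. For negative c n
no stash probability is admissible, so nothing is lost. -/
theorem superpolynomialDecay_mul_exp {c : ℕ → ℝ} (hc : (fun n : ℕ => Real.log n) =o[atTop] c)
    {L : ℕ → ℕ} {d : ℕ} (hL : (fun n : ℕ => (L n : ℝ)) =O[atTop] fun n : ℕ => (n : ℝ) ^ d) :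
    SuperpolynomialDecay atTop (fun n : ℕ => (n : ℝ))
      fun n => ((L n : ℝ) + 1) * Real.exp (3 - |c n|) := by
  have hexp : SuperpolynomialDecay atTop (fun n : ℕ => (n : ℝ)) fun n => Real.exp (3 - |c n|) := by
    intro m
    have hbound : ∀ᶠ n : ℕ in atTop, (n : ℝ) ^ m * Real.exp (3 - |c n|)
        ≤ Real.exp 3 * (n : ℝ)⁻¹ := by
      -- The constant 1/(m+1) gives exp(-|c n|) ≤ n^(-(m+1)), one power of n more than needed to
      -- cancel n^m.
      filter_upwards [hc.bound (show (0 : ℝ) < 1 / (m + 1) by positivity), eventually_gt_atTop 0]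
        with n hn hn0
      have hn' : (0 : ℝ) < n := by exact_mod_cast hn0
      have hlog : (m + 1) * Real.log n ≤ |c n| := by
        have := (le_abs_self _).trans hn
        rw [Real.norm_eq_abs, one_div, inv_mul_eq_div, le_div_iff₀ (by positivity)] at this
        linarith
      calc (n : ℝ) ^ m * Real.exp (3 - |c n|)
          ≤ (n : ℝ) ^ m * Real.exp (3 - (m + 1) * Real.log n) := by gcongr
        _ = Real.exp 3 * (n : ℝ)⁻¹ := by
          have h1 : Real.exp ((m + 1) * Real.log n) = (n : ℝ) ^ (m + 1) := by
            have := Real.exp_nat_mul (Real.log n) (m + 1)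
            rw [Real.exp_log hn'] at this
            exact_mod_cast this
          rw [Real.exp_sub, h1]
          field_simp
          ring
    refine squeeze_zero' (Eventually.of_forall fun n => by positivity) hbound ?_
    simpa using tendsto_inv_atTop_nhds_zero_nat.const_mul (Real.exp 3)
  have h1 : SuperpolynomialDecay atTop (fun n : ℕ => (n : ℝ))
      fun n => (L n : ℝ) * Real.exp (3 - |c n|) := by
    intro m
    have hO : (fun n : ℕ => (n : ℝ) ^ m * ((L n : ℝ) * Real.exp (3 - |c n|)))
        =O[atTop] fun n : ℕ => (n : ℝ) ^ (d + m) * Real.exp (3 - |c n|) := by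
      have := ((isBigO_refl (fun n : ℕ => (n : ℝ) ^ m) atTop).mul hL).mul
        (isBigO_refl (fun n : ℕ => Real.exp (3 - |c n|)) atTop)
      refine (this.congr (fun n => ?_) fun n => ?_)
      · ring
      · ring
    exact hO.trans_tendsto (hexp (d + m))
  simp only [add_mul, one_mul]
  exact h1.add hexp

end DPRAM

theorem mainTheorem1 :
    -- privacy, with a budget of order `log n`
    (∀ k : ℕ, ∃ K : ℝ, ∀ (n : ℕ) [NeZero n] (p : unitInterval), 1 / (n : ℝ) ^ k ≤ p →
      ∀ (Key Block Ct : Type*) (E : DPRAM.EncScheme Key Block Ct) (D : Fin n → Block)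
        (W : ∀ l : ℕ, (Fin l → DPRAM.Query n) → Fin l → Block),
        DPRAM.IsDPAccess
          (fun l Q => (DPRAM.execute E p D Q (W l Q)).map DPRAM.Execution.view)
          (K * Real.log n) 0) ∧
    -- correct answers, and bandwidth per query
    (∀ (n : ℕ) [NeZero n] (p : unitInterval)
      (Key Block Ct : Type*) (E : DPRAM.EncScheme Key Block Ct) (D : Fin n → Block)
      (l : ℕ) (Q : Fin l → DPRAM.Query n) (W : Fin l → Block),
      ∀ e ∈ (DPRAM.execute E p D Q W).support,
        e.answers = DPRAM.plainAnswers D (DPRAM.inputs Q W) ∧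
        e.view.length = l ∧
        ∀ ops ∈ e.view, ops.countP DPRAM.ServerOp.isDownload ≤ 2 ∧
          ops.countP DPRAM.ServerOp.isUpload ≤ 1) ∧
    -- client storage
    (∃ A : ℝ, ∀ c : ℕ → ℝ, (fun n : ℕ => Real.log n) =o[atTop] c →
      ∀ (L : ℕ → ℕ) (d : ℕ), (fun n : ℕ => (L n : ℝ)) =O[atTop] (fun n : ℕ => (n : ℝ) ^ d) →
      ∃ ν : ℕ → ℝ, SuperpolynomialDecay atTop (fun n : ℕ => (n : ℝ)) ν ∧
        ∀ (n : ℕ) [NeZero n] (p : unitInterval), (p : ℝ) ≤ c n / n →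
        ∀ (Key Block Ct : Type*) (E : DPRAM.EncScheme Key Block Ct) (D : Fin n → Block)
          (l : ℕ), l ≤ L n → ∀ (Q : Fin l → DPRAM.Query n) (W : Fin l → Block),
          (DPRAM.execute E p D Q W).toOuterMeasure
              {e | ∃ m ∈ e.clientLoads, A * c n < (m : ℝ)} ≤ ENNReal.ofReal (ν n)) := by
  -- With threshold 3 · c n and n · p ≤ c n, the Chernoff exponent 3 + 2np - 3 · c n is at most 3 -
  -- c n; the leading 3 accounts for the working blocks.
  refine ⟨fun k => ⟨(6 + 3 * k : ℕ), fun n _ p hp Key Block Ct E D W =>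
    DPRAM.isDPAccess_execute k p hp E D W⟩, ?_, 3, fun c hc L d hL => ⟨_,
      DPRAM.superpolynomialDecay_mul_exp hc hL, ?_⟩⟩
  · intro n _ p Key Block Ct E D l Q W e he
    simp only [DPRAM.execute, PMF.mem_support_bind_iff] at he
    obtain ⟨s, hs, he⟩ := he
    obtain ⟨h1, h2, h3⟩ :=
      DPRAM.run_spec _ (DPRAM.represents_of_mem_support_setup hs) e he
    refine ⟨h1, by simpa [DPRAM.inputs] using h2, fun ops hops => ?_⟩
    obtain ⟨a, rfl⟩ := h3 ops hops
    exact ⟨le_rfl, le_rfl⟩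
  · intro n _ p hp Key Block Ct E D l hl Q W
    have hn : (0 : ℝ) < n := by exact_mod_cast Nat.pos_of_ne_zero (NeZero.ne n)
    have hnp : n * (p : ℝ) ≤ c n := by
      rw [le_div_iff₀ hn] at hp
      linarith
    have hc0 : 0 ≤ c n := (mul_nonneg hn.le p.2.1).trans hnp
    refine (DPRAM.execute_toOuterMeasure_load_le E p D Q W _).trans
      (ENNReal.ofReal_le_ofReal ?_)
    rw [abs_of_nonneg hc0]
    exact mul_le_mul (by gcongr) (Real.exp_le_exp.2 (by linarith)) (Real.exp_pos _).le
      (by positivity)
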